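/- **Setting.** Consider first-order formulas over an arbitrary set of propositional symbols (arity $0$) and an arbitrary set of predicate symbols of positive arity, without equality, function symbols or object constants, built with $\top,\bot,\neg,\&,\vee,\supset,\forall,\exists$; there are infinitely many variables, and formulas may contain free variables. $\mathrm{LJ}^+$ is Gentzen's intuitionistic sequent calculus $\mathrm{LJ}$ (with cut, and with the axioms $\vdash\top$ and $\bot\vdash$) extended by the neutralization rule: from $N,\Gamma\vdash\Lambda$ and $\neg N,\Gamma\vdash\Lambda$ infer $\Gamma\vdash\Lambda$, where $N$ is any propositional formula, i.e. a formula containing no predicate symbols. A formula $F$ is derivable in $\mathrm{LJ}^+$ if the sequent $\vdash F$ is. An occurrence of a propositional symbol in a formula $F$ is positive (negative) in $F$ if it lies within an even (odd) number of negations and left-hand sides of implications. A formula is *unipolar* if, for every propositional symbol, its occurrences in the formula are all positive or all negative. The *existence property* holds for $\exists x\,F(x)$ if derivability of $\exists x\,F(x)$ in $\mathrm{LJ}^+$ implies that $F(t)$ is derivable in $\mathrm{LJ}^+$ for some variable $t$. **Theorem.** Let $A(x)$ be a unipolar formula and let $B$ be a formula in which $x$ does not occur free. The existence property holds for each of the following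 formulas. 1. $\exists x\,(A(x)\,\&\,B)$. 2. $\exists x\,(A(x)\vee B)$, provided that every propositional symbol occurring in both $A(x)$ and $B$ has only positive or only negative occurrences in $A(x)\vee B$. 3. $\exists x\,(B\supset A(x))$, provided that $B$ is propositional and that every propositional symbol occurring in both $A(x)$ and $B$ has only positive or only negative occurrences in $B\supset A(x)$. -/

import Mathlib

namespace LJP

universe u v

/-- An individual variable inside `n` quantifiers: a free variable, taken from a countably infinite
supply, or a bound variable, given by its de Bruijn index. There are no function symbols and no
object constants. -/
inductive Var (n : ℕ) : Type
  | free (a : ℕ) : Var n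
  | bound (i : Fin n) : Var n

/-- First-order formulas inside `n` quantifiers. `P` is the set of propositional symbols, and `R k`
is the set of predicate symbols of arity `k + 1`, so that predicate symbols have positive arity.
Formulas in the usual sense are those with `n = 0`; formulas `A(x)` with a distinguished variable
`x` that can be quantified or instantiated are those with `n = 1`. -/
inductive Formula (P : Type u) (R : ℕ → Type v) : ℕ → Type (max u v)
  | top {n : ℕ} : Formula P R n
  | bot {n : ℕ} : Formula P R n
  | prop {n : ℕ} (p : P) : Formula P R n
  | pred {n k : ℕ} (r : R k) (ts : Fin (k + 1) → Var n) : Formula P R n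
  | neg {n : ℕ} (A : Formula P R n) : Formula P R n
  | and {n : ℕ} (A B : Formula P R n) : Formula P R n
  | or {n : ℕ} (A B : Formula P R n) : Formula P R n
  | imp {n : ℕ} (A B : Formula P R n) : Formula P R n
  | all {n : ℕ} (A : Formula P R (n + 1)) : Formula P R n
  | ex {n : ℕ} (A : Formula P R (n + 1)) : Formula P R n

/-- Replace the bound variables of a variable according to `σ`. -/
def Var.subst {n m : ℕ} (σ : Fin n → Var m) : Var n → Var m
  | .free a => .free a
  | .bound i => σ i

/-- The replacement `σ` carried under one more quantifier: the new bound variable stays fixed. -/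
def Var.lift {n m : ℕ} (σ : Fin n → Var m) : Fin (n + 1) → Var (m + 1) :=
  Fin.cases (.bound 0) (fun i => (σ i).subst (fun j => .bound j.succ))

namespace Formula

variable {P : Type u} {R : ℕ → Type v}

/-- Simultaneous (capture-free) replacement of the `n` outer bound variables according to `σ`. -/
def subst : {n m : ℕ} → (Fin n → Var m) → Formula P R n → Formula P R m
  | _, _, _, .top => .top
  | _, _, _, .bot => .bot
  | _, _, _, .prop p => .prop p
  | _, _, σ, .pred r ts => .pred r (fun i => (ts i).subst σ)
  | _, _, σ, .neg A => .neg (A.subst σ)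
  | _, _, σ, .and A B => .and (A.subst σ) (B.subst σ)
  | _, _, σ, .or A B => .or (A.subst σ) (B.subst σ)
  | _, _, σ, .imp A B => .imp (A.subst σ) (B.subst σ)
  | _, _, σ, .all A => .all (A.subst (Var.lift σ))
  | _, _, σ, .ex A => .ex (A.subst (Var.lift σ))

/-- `A.inst a` is `A(a)`, where `A` is `A(x)` and `a` is a free variable. -/
def inst (A : Formula P R 1) (a : ℕ) : Formula P R 0 :=
  A.subst (fun _ => .free a)

/-- A formula `B`, regarded as a formula `B(x)` in which `x` does not occur. -/
def weaken (B : Formula P R 0) : Formula P R 1 :=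
  B.subst Fin.elim0

/-- The free variable `a` occurs in the formula. -/
def HasVar (a : ℕ) : {n : ℕ} → Formula P R n → Prop
  | _, .top => False
  | _, .bot => False
  | _, .prop _ => False
  | _, .pred _ ts => ∃ i, ts i = .free a
  | _, .neg A => A.HasVar a
  | _, .and A B => A.HasVar a ∨ B.HasVar a
  | _, .or A B => A.HasVar a ∨ B.HasVar a
  | _, .imp A B => A.HasVar a ∨ B.HasVar a
  | _, .all A => A.HasVar a
  | _, .ex A => A.HasVar a

/-- A formula is propositional if it contains no predicate symbols. -/
def IsPropositional : {n : ℕ} → Formula P R n → Prop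
  | _, .top => True
  | _, .bot => True
  | _, .prop _ => True
  | _, .pred _ _ => False
  | _, .neg A => A.IsPropositional
  | _, .and A B => A.IsPropositional ∧ B.IsPropositional
  | _, .or A B => A.IsPropositional ∧ B.IsPropositional
  | _, .imp A B => A.IsPropositional ∧ B.IsPropositional
  | _, .all A => A.IsPropositional
  | _, .ex A => A.IsPropositional

/-- `A.Occ p true` (`A.Occ p false`): the propositional symbol `p` has a positive (negative)
occurrence in `A`. Polarity is reversed by negation and on the left of an implication. -/
def Occ (p : P) : {n : ℕ} → Formula P R n → Bool → Prop
  | _, .top, _ => False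
  | _, .bot, _ => False
  | _, .prop q, s => q = p ∧ s = true
  | _, .pred _ _, _ => False
  | _, .neg A, s => A.Occ p (!s)
  | _, .and A B, s => A.Occ p s ∨ B.Occ p s
  | _, .or A B, s => A.Occ p s ∨ B.Occ p s
  | _, .imp A B, s => A.Occ p (!s) ∨ B.Occ p s
  | _, .all A, s => A.Occ p s
  | _, .ex A, s => A.Occ p s

/-- The propositional symbol `p` occurs in `A`. -/
def Contains {n : ℕ} (A : Formula P R n) (p : P) : Prop :=
  A.Occ p true ∨ A.Occ p false

/-- The occurrences of `p` in `A` are all positive or all negative. -/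
def UnipolarAt {n : ℕ} (A : Formula P R n) (p : P) : Prop :=
  ¬ A.Occ p false ∨ ¬ A.Occ p true

/-- The occurrences of every propositional symbol in `A` are all positive or all negative. -/
def Unipolar {n : ℕ} (A : Formula P R n) : Prop :=
  ∀ p : P, A.UnipolarAt p

end Formula

/-- Derivability of sequents `Γ ⊢ Λ` in LJ⁺: Gentzen's LJ (with cut, and with the constants `⊤`
and `⊥`) together with the neutralization rule. The antecedent is a finite sequence of formulas, and
the succedent is a formula or empty. -/
inductive LJPlus {P : Type u} {R : ℕ → Type v} :
    List (Formula P R 0) → Option (Formula P R 0) → Prop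
  | ax (A) : LJPlus [A] (some A)
  | top_ax : LJPlus [] (some .top)
  | bot_ax : LJPlus [.bot] none
  | thin_left {A Γ Λ} : LJPlus Γ Λ → LJPlus (A :: Γ) Λ
  | thin_right {A Γ} : LJPlus Γ none → LJPlus Γ (some A)
  | contraction {A Γ Λ} : LJPlus (A :: A :: Γ) Λ → LJPlus (A :: Γ) Λ
  | exchange {Δ A B Γ Λ} : LJPlus (Δ ++ A :: B :: Γ) Λ → LJPlus (Δ ++ B :: A :: Γ) Λ
  | cut {C Γ Δ Λ} : LJPlus Γ (some C) → LJPlus (C :: Δ) Λ → LJPlus (Γ ++ Δ) Λ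
  | and_right {A B Γ} : LJPlus Γ (some A) → LJPlus Γ (some B) → LJPlus Γ (some (.and A B))
  | and_left₁ {A B Γ Λ} : LJPlus (A :: Γ) Λ → LJPlus (.and A B :: Γ) Λ
  | and_left₂ {A B Γ Λ} : LJPlus (B :: Γ) Λ → LJPlus (.and A B :: Γ) Λ
  | or_left {A B Γ Λ} : LJPlus (A :: Γ) Λ → LJPlus (B :: Γ) Λ → LJPlus (.or A B :: Γ) Λ
  | or_right₁ {A B Γ} : LJPlus Γ (some A) → LJPlus Γ (some (.or A B))
  | or_right₂ {A B Γ} : LJPlus Γ (some B) → LJPlus Γ (some (.or A B))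
  | neg_right {A Γ} : LJPlus (A :: Γ) none → LJPlus Γ (some (.neg A))
  | neg_left {A Γ} : LJPlus Γ (some A) → LJPlus (.neg A :: Γ) none
  | imp_right {A B Γ} : LJPlus (A :: Γ) (some B) → LJPlus Γ (some (.imp A B))
  | imp_left {A B Γ Δ Λ} : LJPlus Γ (some A) → LJPlus (B :: Δ) Λ →
      LJPlus (.imp A B :: (Γ ++ Δ)) Λ
  | all_right {F : Formula P R 1} {Γ} (a : ℕ) (hF : ¬ F.HasVar a) (hΓ : ∀ G ∈ Γ, ¬ G.HasVar a) :
      LJPlus Γ (some (F.inst a)) → LJPlus Γ (some (.all F))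
  | all_left {F : Formula P R 1} {Γ Λ} (a : ℕ) : LJPlus (F.inst a :: Γ) Λ → LJPlus (.all F :: Γ) Λ
  | ex_right {F : Formula P R 1} {Γ} (a : ℕ) : LJPlus Γ (some (F.inst a)) → LJPlus Γ (some (.ex F))
  | ex_left {F : Formula P R 1} {Γ Λ} (a : ℕ) (hF : ¬ F.HasVar a) (hΓ : ∀ G ∈ Γ, ¬ G.HasVar a)
      (hΛ : ∀ G ∈ Λ, ¬ G.HasVar a) : LJPlus (F.inst a :: Γ) Λ → LJPlus (.ex F :: Γ) Λ
  | neutralization {N Γ Λ} (hN : N.IsPropositional) :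
      LJPlus (N :: Γ) Λ → LJPlus (.neg N :: Γ) Λ → LJPlus Γ Λ

/-- A formula is derivable in LJ⁺ if the sequent with empty antecedent and this succedent is. -/
def Derivable {P : Type u} {R : ℕ → Type v} (A : Formula P R 0) : Prop :=
  LJPlus [] (some A)

/-- The existence property of LJ⁺ for the formula `∃x F(x)`: if it is derivable, then `F(a)` is
derivable for some variable `a`. -/
def ExistenceProperty {P : Type u} {R : ℕ → Type v} (F : Formula P R 1) : Prop :=
  Derivable (.ex F) → ∃ a : ℕ, Derivable (F.inst a)

end LJP

/-!
Replacing the propositional symbols of a formula by truth values turns LJ⁺-derivations into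
LJ⁺-derivations in a language without propositional symbols. There every propositional formula is
derivable or refutable, so neutralization respects Kleene's slash, and LJ⁺ has the disjunction and
existence properties for all formulas. The obstacle to returning to the original language is that
the witness may depend on the truth values. Neutralization lets one argue by cases on the truth
values of finitely many symbols, and by monotonicity it is enough to consider the values that make
the formula as strong as possible. For a unipolar `A(x)` a single choice on the symbols of `A(x)` is
strongest (positive symbols false, negative symbols true), and therefore one witness suffices. The
polarity conditions on `B` ensure that this choice is also strongest for `B`, or for `¬B`, on the
shared symbols.
-/

namespace LJP

universe u v w

variable {P : Type u} {Q : Type w} {R : ℕ → Type v}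

/-- Renaming of the free variables of a variable. -/
def Var.rename {n : ℕ} (ρ : ℕ → ℕ) : Var n → Var n
  | .free a => .free (ρ a)
  | .bound i => .bound i

theorem Var.rename_id {n : ℕ} (x : Var n) : x.rename id = x := by
  cases x <;> rfl

theorem Var.rename_rename {n : ℕ} (ρ τ : ℕ → ℕ) (x : Var n) :
    (x.rename ρ).rename τ = x.rename (τ ∘ ρ) := by
  cases x <;> rfl

theorem Var.rename_subst {n m : ℕ} (ρ : ℕ → ℕ) (σ : Fin n → Var m) (x : Var n) :
    (x.subst σ).rename ρ = (x.rename ρ).subst fun i => (σ i).rename ρ := by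
  cases x <;> rfl

theorem Var.lift_rename {n m : ℕ} (ρ : ℕ → ℕ) (σ : Fin n → Var m) :
    Var.lift (fun i => (σ i).rename ρ) = fun i => (Var.lift σ i).rename ρ := by
  funext i
  cases i using Fin.cases with
  | zero => rfl
  | succ j => simp only [Var.lift, Fin.cases_succ]; cases σ j <;> rfl

theorem Var.lift_subst_lift {n m : ℕ} {σ : Fin n → Var m} {τ : Fin m → Var n}
    (h : ∀ i, (σ i).subst τ = .bound i) (i : Fin (n + 1)) :
    (Var.lift σ i).subst (Var.lift τ) = .bound i := by
  cases i using Fin.cases with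
  | zero => rfl
  | succ j =>
    have hj := h j
    simp only [Var.lift, Fin.cases_succ]
    cases hσ : σ j with
    | free a => simp [hσ, Var.subst] at hj
    | bound k =>
      have hτ : τ k = .bound j := by simpa only [hσ, Var.subst] using hj
      simp only [Var.subst, Var.lift, Fin.cases_succ, hτ]

namespace Formula

theorem subst_subst_cancel {n : ℕ} (A : Formula P R n) {m : ℕ} {σ : Fin n → Var m}
    {τ : Fin m → Var n} (h : ∀ i, (σ i).subst τ = .bound i) : (A.subst σ).subst τ = A := by
  induction A generalizing m with
  | pred r ts =>
    simp only [subst, pred.injEq, heq_eq_eq, true_and]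
    funext i
    cases ts i with
    | free a => rfl
    | bound j => exact h j
  | neg A ih => simp only [subst, ih h]
  | and A B ihA ihB | or A B ihA ihB | imp A B ihA ihB => simp only [subst, ihA h, ihB h]
  | all A ih | ex A ih => simp only [subst, ih (Var.lift_subst_lift h)]
  | _ => rfl

theorem weaken_inst (B : Formula P R 0) (a : ℕ) : B.weaken.inst a = B :=
  B.subst_subst_cancel fun i => i.elim0

theorem and_weaken_inst (A : Formula P R 1) (B : Formula P R 0) (a : ℕ) :
    (Formula.and A B.weaken).inst a = .and (A.inst a) B :=
  congrArg (Formula.and _) (B.weaken_inst a)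

theorem or_weaken_inst (A : Formula P R 1) (B : Formula P R 0) (a : ℕ) :
    (Formula.or A B.weaken).inst a = .or (A.inst a) B :=
  congrArg (Formula.or _) (B.weaken_inst a)

theorem imp_weaken_inst (A : Formula P R 1) (B : Formula P R 0) (a : ℕ) :
    (Formula.imp B.weaken A).inst a = .imp B (A.inst a) :=
  congrArg (Formula.imp · _) (B.weaken_inst a)

theorem occ_subst {p : P} {n m : ℕ} {A : Formula P R n} {σ : Fin n → Var m} {s : Bool} :
    (A.subst σ).Occ p s ↔ A.Occ p s := by
  induction A generalizing m s with
  | _ => simp_all only [subst, Occ]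

theorem occ_inst {p : P} {A : Formula P R 1} {a : ℕ} {s : Bool} :
    (A.inst a).Occ p s ↔ A.Occ p s :=
  occ_subst

theorem isPropositional_subst {n m : ℕ} {A : Formula P R n} {σ : Fin n → Var m} :
    (A.subst σ).IsPropositional ↔ A.IsPropositional := by
  induction A generalizing m with
  | _ => simp_all only [subst, IsPropositional]

theorem finite_setOf_hasVar {n : ℕ} (A : Formula P R n) : {a | A.HasVar a}.Finite := by
  induction A with
  | pred _ ts => exact (Set.finite_range ts).preimage (f := Var.free) fun _ _ _ _ => Var.free.inj
  | and A B ihA ihB | or A B ihA ihB | imp A B ihA ihB => exact ihA.union ihB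
  | neg _ ih | all _ ih | ex _ ih => exact ih
  | _ => exact Set.finite_empty

theorem exists_forall_not_hasVar (F : Formula P R 1) (Γ : List (Formula P R 0)) :
    ∃ a, ¬ F.HasVar a ∧ ∀ G ∈ Γ, ¬ G.HasVar a := by
  have hfin : ({a | F.HasVar a} ∪ ⋃ G ∈ {G | G ∈ Γ}, {a | G.HasVar a}).Finite :=
    F.finite_setOf_hasVar.union (Γ.finite_toSet.biUnion fun G _ => G.finite_setOf_hasVar)
  obtain ⟨a, ha⟩ := hfin.exists_notMem
  simp only [Set.mem_union, Set.mem_iUnion, Set.mem_ofPred_eq, exists_prop, not_or, not_exists,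
    not_and] at ha
  exact ⟨a, ha⟩

theorem contains_iff_exists_occ {n : ℕ} {A : Formula P R n} {p : P} :
    A.Contains p ↔ ∃ s, A.Occ p s := by
  rw [Bool.exists_bool, or_comm, Contains]

theorem finite_setOf_contains {n : ℕ} (A : Formula P R n) : {p | A.Contains p}.Finite := by
  simp only [contains_iff_exists_occ]
  induction A with
  | prop q => exact (Set.finite_singleton q).subset fun p ⟨_, h, _⟩ => h.symm
  | neg A ih => exact ih.subset fun p ⟨s, h⟩ => ⟨!s, h⟩
  | and A B ihA ihB | or A B ihA ihB =>
    exact (ihA.union ihB).subset fun p ⟨s, h⟩ => h.imp (⟨s, ·⟩) (⟨s, ·⟩)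
  | imp A B ihA ihB =>
    exact (ihA.union ihB).subset fun p ⟨s, h⟩ => h.imp (⟨!s, ·⟩) (⟨s, ·⟩)
  | all _ ih | ex _ ih => exact ih
  | _ => exact Set.finite_empty.subset fun p ⟨_, h⟩ => h

theorem UnipolarAt.occ_unique {n : ℕ} {A : Formula P R n} {p : P} {s t : Bool}
    (h : A.UnipolarAt p) (hs : A.Occ p s) (ht : A.Occ p t) : s = t := by
  cases s <;> cases t <;> first | rfl | (cases h <;> contradiction)

/-- The number of logical symbols, the measure for recursion from `∀x A(x)` and `∃x A(x)` to the
instances `A(a)`. -/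
def size : {n : ℕ} → Formula P R n → ℕ
  | _, .top => 0
  | _, .bot => 0
  | _, .prop _ => 0
  | _, .pred _ _ => 0
  | _, .neg A => A.size + 1
  | _, .and A B => A.size + B.size + 1
  | _, .or A B => A.size + B.size + 1
  | _, .imp A B => A.size + B.size + 1
  | _, .all A => A.size + 1
  | _, .ex A => A.size + 1

theorem size_subst {n m : ℕ} (A : Formula P R n) (σ : Fin n → Var m) :
    (A.subst σ).size = A.size := by
  induction A generalizing m with
  | _ => simp_all only [subst, size]

theorem size_inst (A : Formula P R 1) (a : ℕ) : (A.inst a).size = A.size :=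
  A.size_subst _

@[elab_as_elim]
theorem inst_induction {motive : Formula P R 0 → Prop} (top : motive .top) (bot : motive .bot)
    (prop : ∀ p, motive (.prop p))
    (pred : ∀ {k} (r : R k) (ts : Fin (k + 1) → Var 0), motive (.pred r ts))
    (neg : ∀ A, motive A → motive (.neg A))
    (and : ∀ A B, motive A → motive B → motive (.and A B))
    (or : ∀ A B, motive A → motive B → motive (.or A B))
    (imp : ∀ A B, motive A → motive B → motive (.imp A B))
    (all : ∀ A : Formula P R 1, (∀ a, motive (A.inst a)) → motive (.all A))
    (ex : ∀ A : Formula P R 1, (∀ a, motive (A.inst a)) → motive (.ex A))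
    (A : Formula P R 0) : motive A := by
  induction hn : A.size using Nat.strong_induction_on generalizing A with
  | _ n ih =>
    subst hn
    have ih' : ∀ B : Formula P R 0, B.size < A.size → motive B := fun B hB => ih _ hB B rfl
    cases A with
    | top => exact top
    | bot => exact bot
    | prop p => exact prop p
    | pred r ts => exact pred r ts
    | neg A => exact neg A (ih' A (by simp only [size]; omega))
    | and A B =>
      exact and A B (ih' A (by simp only [size]; omega)) (ih' B (by simp only [size]; omega))
    | or A B =>
      exact or A B (ih' A (by simp only [size]; omega)) (ih' B (by simp only [size]; omega))
    | imp A B =>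
      exact imp A B (ih' A (by simp only [size]; omega)) (ih' B (by simp only [size]; omega))
    | all A => exact all A fun a => ih' _ (by simp only [size_inst, size]; omega)
    | ex A => exact ex A fun a => ih' _ (by simp only [size_inst, size]; omega)

/-- The constant `⊤` or `⊥` denoting a truth value. -/
def ofBool {n : ℕ} : Bool → Formula P R n
  | true => .top
  | false => .bot

/-- Replacement of the propositional symbols by their truth values under `v`, together with a
renaming `ρ` of the free variables. The result contains no propositional symbols and is read in a
language with an arbitrary set `Q` of them. -/
def interp (v : P → Bool) (ρ : ℕ → ℕ) : {n : ℕ} → Formula P R n → Formula Q R n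
  | _, .top => .top
  | _, .bot => .bot
  | _, .prop p => ofBool (v p)
  | _, .pred r ts => .pred r fun i => (ts i).rename ρ
  | _, .neg A => .neg (A.interp v ρ)
  | _, .and A B => .and (A.interp v ρ) (B.interp v ρ)
  | _, .or A B => .or (A.interp v ρ) (B.interp v ρ)
  | _, .imp A B => .imp (A.interp v ρ) (B.interp v ρ)
  | _, .all A => .all (A.interp v ρ)
  | _, .ex A => .ex (A.interp v ρ)

theorem interp_interp {n : ℕ} (v : P → Bool) (w : Q → Bool) (ρ τ : ℕ → ℕ) (A : Formula P R n) :
    ((A.interp v ρ : Formula Q R n).interp w τ : Formula P R n) = A.interp v (τ ∘ ρ) := by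
  induction A with
  | prop p => simp only [interp]; cases v p <;> rfl
  | _ => simp_all only [interp, Var.rename_rename]

theorem interp_subst {n m : ℕ} (v : P → Bool) (ρ : ℕ → ℕ) (A : Formula P R n)
    (σ : Fin n → Var m) : ((A.subst σ).interp v ρ : Formula Q R m) =
      (A.interp v ρ).subst fun i => (σ i).rename ρ := by
  induction A generalizing m with
  | prop p => simp only [subst, interp]; cases v p <;> rfl
  | _ => simp_all only [subst, interp, Var.rename_subst, Var.lift_rename]

theorem interp_inst (v : P → Bool) (ρ : ℕ → ℕ) (A : Formula P R 1) (a : ℕ) :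
    ((A.inst a).interp v ρ : Formula Q R 0) = (A.interp v ρ).inst (ρ a) :=
  A.interp_subst v ρ _

theorem interp_update {n : ℕ} {A : Formula P R n} {a : ℕ} (hA : ¬ A.HasVar a) (v : P → Bool)
    (ρ : ℕ → ℕ) (b : ℕ) :
    (A.interp v (Function.update ρ a b) : Formula Q R n) = A.interp v ρ := by
  induction A with
  | pred r ts =>
    simp only [interp, pred.injEq, heq_eq_eq, true_and]
    funext i
    cases hi : ts i with
    | free c =>
      have hca : c ≠ a := fun h => hA ⟨i, h ▸ hi⟩
      simp only [Var.rename, Function.update_of_ne hca]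
    | bound j => rfl
  | _ => simp_all only [HasVar, not_or, not_false_eq_true, interp]

theorem interp_update_inst {F : Formula P R 1} {a : ℕ} (hF : ¬ F.HasVar a) (v : P → Bool)
    (ρ : ℕ → ℕ) (b : ℕ) :
    ((F.inst a).interp v (Function.update ρ a b) : Formula Q R 0) = (F.interp v ρ).inst b := by
  rw [interp_inst, interp_update hF, Function.update_self]

theorem IsPropositional.interp {n : ℕ} {A : Formula P R n} (hA : A.IsPropositional)
    (v : P → Bool) (ρ : ℕ → ℕ) : (A.interp v ρ : Formula Q R n).IsPropositional := by
  induction A with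
  | prop p => simp only [Formula.interp]; cases v p <;> trivial
  | _ => simp_all only [Formula.interp, IsPropositional, and_self]

end Formula

open Formula

namespace LJPlus

variable {Γ Δ : List (Formula P R 0)} {Λ : Option (Formula P R 0)} {A A' B B' : Formula P R 0}

theorem perm_append_left (h : Γ.Perm Δ) (Θ : List (Formula P R 0)) (hΓ : LJPlus (Θ ++ Γ) Λ) :
    LJPlus (Θ ++ Δ) Λ := by
  induction h generalizing Θ with
  | nil => exact hΓ
  | cons A _ ih => simpa using ih (Θ ++ [A]) (by simpa using hΓ)
  | swap => exact exchange hΓ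
  | trans _ _ ih₁ ih₂ => exact ih₂ Θ (ih₁ Θ hΓ)

theorem perm (h : Γ.Perm Δ) (hΓ : LJPlus Γ Λ) : LJPlus Δ Λ :=
  perm_append_left h [] hΓ

theorem thin_append (h : LJPlus Γ Λ) : ∀ Δ : List (Formula P R 0), LJPlus (Δ ++ Γ) Λ
  | [] => h
  | _ :: Δ => thin_left (thin_append h Δ)

theorem contract_of_mem (hA : A ∈ Γ) (h : LJPlus (A :: Γ) Λ) : LJPlus Γ Λ := by
  classical
  have hperm := List.perm_cons_erase hA
  exact perm hperm.symm (contraction (perm (hperm.cons A) h))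

theorem contract_of_subset : ∀ Γ : List (Formula P R 0), Γ ⊆ Δ → LJPlus (Γ ++ Δ) Λ → LJPlus Δ Λ
  | [], _, h => h
  | _ :: Γ, hΓ, h =>
    contract_of_subset Γ (List.cons_subset.1 hΓ).2
      (contract_of_mem (List.mem_append_right Γ (List.cons_subset.1 hΓ).1) h)

theorem mono (hs : Γ ⊆ Δ) (h : LJPlus Γ Λ) : LJPlus Δ Λ :=
  contract_of_subset Γ hs (perm List.perm_append_comm (thin_append h Δ))

theorem of_mem (hA : A ∈ Γ) : LJPlus Γ (some A) :=
  mono (by simpa using hA) (ax A)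

theorem of_bot_mem (h : .bot ∈ Γ) : LJPlus Γ (some A) :=
  mono (by simpa using h) (thin_right bot_ax)

theorem of_mem_of_neg_mem (hA : A ∈ Γ) (hA' : .neg A ∈ Γ) : LJPlus Γ (some B) :=
  mono (by simpa using ⟨hA', hA⟩) (thin_right (neg_left (ax A)))

theorem of_derivable (h : Derivable A) : LJPlus Γ (some A) :=
  mono (List.nil_subset Γ) h

theorem cut_derivable (hA : Derivable A) (h : LJPlus (A :: Γ) Λ) : LJPlus Γ Λ :=
  cut (Γ := []) hA h

theorem cut_derivable_list : ∀ Γ : List (Formula P R 0), (∀ G ∈ Γ, Derivable G) →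
    LJPlus (Γ ++ Δ) Λ → LJPlus Δ Λ
  | [], _, h => h
  | _ :: Γ, hΓ, h =>
    cut_derivable_list Γ (List.forall_mem_cons.1 hΓ).2
      (cut_derivable (List.forall_mem_cons.1 hΓ).1 h)

theorem cons_of_derivable_neg (h : Derivable (.neg A)) : LJPlus [A] none :=
  cut_derivable h (neg_left (ax A))

theorem all_right_of_forall {F : Formula P R 1} (h : ∀ a, LJPlus Γ (some (F.inst a))) :
    LJPlus Γ (some (.all F)) := by
  obtain ⟨a, hF, hΓ⟩ := F.exists_forall_not_hasVar Γ
  exact all_right a hF hΓ (h a)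

theorem ex_left_of_forall {F : Formula P R 1} (h : ∀ a, LJPlus (F.inst a :: Γ) Λ) :
    LJPlus (.ex F :: Γ) Λ := by
  obtain ⟨a, hF, hΓΛ⟩ := F.exists_forall_not_hasVar (Γ ++ Λ.toList)
  rw [List.forall_mem_append] at hΓΛ
  exact ex_left a hF hΓΛ.1 (fun G hG => hΓΛ.2 G (Option.mem_toList.2 hG)) (h a)

theorem imp_left_of_same (hA : LJPlus Γ (some A)) (hB : LJPlus (B :: Γ) Λ) :
    LJPlus (.imp A B :: Γ) Λ :=
  mono (by simp) (imp_left hA hB)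

theorem neg_mono (h : LJPlus (A' :: Γ) (some A)) : LJPlus (.neg A :: Γ) (some (.neg A')) :=
  neg_right (perm (.swap _ _ _) (neg_left h))

theorem and_mono (hA : LJPlus (A :: Γ) (some A')) (hB : LJPlus (B :: Γ) (some B')) :
    LJPlus (.and A B :: Γ) (some (.and A' B')) :=
  and_right (and_left₁ hA) (and_left₂ hB)

theorem or_mono (hA : LJPlus (A :: Γ) (some A')) (hB : LJPlus (B :: Γ) (some B')) :
    LJPlus (.or A B :: Γ) (some (.or A' B')) :=
  or_left (or_right₁ hA) (or_right₂ hB)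

theorem imp_mono (hA : LJPlus (A' :: Γ) (some A)) (hB : LJPlus (B :: Γ) (some B')) :
    LJPlus (.imp A B :: Γ) (some (.imp A' B')) :=
  imp_right (perm (.swap _ _ _) (imp_left_of_same hA (perm (.swap _ _ _) (thin_left hB))))

theorem all_mono {F F' : Formula P R 1}
    (h : ∀ a, LJPlus (F.inst a :: Γ) (some (F'.inst a))) :
    LJPlus (.all F :: Γ) (some (.all F')) := by
  obtain ⟨a, hF', hΓ⟩ := F'.exists_forall_not_hasVar (.all F :: Γ)
  exact all_right a hF' hΓ (all_left a (h a))

theorem ex_mono {F F' : Formula P R 1}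
    (h : ∀ a, LJPlus (F.inst a :: Γ) (some (F'.inst a))) :
    LJPlus (.ex F :: Γ) (some (.ex F')) :=
  ex_left_of_forall fun a => ex_right a (h a)

theorem map_interp_update {a : ℕ} (hΓ : ∀ G ∈ Γ, ¬ G.HasVar a) (v : P → Bool) (ρ : ℕ → ℕ)
    (b : ℕ) : Γ.map (interp v (Function.update ρ a b)) =
      (Γ.map (interp v ρ) : List (Formula Q R 0)) :=
  List.map_congr_left fun G hG => interp_update (hΓ G hG) v ρ b

theorem option_map_interp_update {a : ℕ} (hΛ : ∀ G ∈ Λ, ¬ G.HasVar a) (v : P → Bool) (ρ : ℕ → ℕ)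
    (b : ℕ) : Λ.map (interp v (Function.update ρ a b)) =
      (Λ.map (interp v ρ) : Option (Formula Q R 0)) :=
  Option.map_congr fun G hG => interp_update (hΛ G hG) v ρ b

protected theorem interp (h : LJPlus Γ Λ) (v : P → Bool) (ρ : ℕ → ℕ) :
    LJPlus (Γ.map (interp v ρ)) (Λ.map (interp v ρ) : Option (Formula Q R 0)) := by
  induction h generalizing ρ with
  | ax A => exact ax _
  | top_ax => exact top_ax
  | bot_ax => exact bot_ax
  | thin_left _ ih => exact thin_left (ih ρ)
  | thin_right _ ih => exact thin_right (ih ρ)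
  | contraction _ ih => exact contraction (ih ρ)
  | exchange _ ih =>
    simp only [List.map_append, List.map_cons] at ih ⊢
    exact exchange (ih ρ)
  | cut _ _ ih₁ ih₂ => exact List.map_append ▸ cut (ih₁ ρ) (ih₂ ρ)
  | and_right _ _ ih₁ ih₂ => exact and_right (ih₁ ρ) (ih₂ ρ)
  | and_left₁ _ ih => exact and_left₁ (ih ρ)
  | and_left₂ _ ih => exact and_left₂ (ih ρ)
  | or_left _ _ ih₁ ih₂ => exact or_left (ih₁ ρ) (ih₂ ρ)
  | or_right₁ _ ih => exact or_right₁ (ih ρ)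
  | or_right₂ _ ih => exact or_right₂ (ih ρ)
  | neg_right _ ih => exact neg_right (ih ρ)
  | neg_left _ ih => exact neg_left (ih ρ)
  | imp_right _ ih => exact imp_right (ih ρ)
  | imp_left _ _ ih₁ ih₂ =>
    rw [List.map_cons, List.map_append]
    exact imp_left (ih₁ ρ) (ih₂ ρ)
  | all_right a hF hΓ _ ih =>
    refine all_right_of_forall fun b => ?_
    have ihb := ih (Function.update ρ a b)
    rwa [map_interp_update hΓ, Option.map_some, interp_update_inst hF] at ihb
  | all_left a _ ih =>
    simp only [List.map_cons, interp_inst] at ih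
    exact all_left (ρ a) (ih ρ)
  | ex_right a _ ih =>
    simp only [Option.map_some, interp_inst] at ih
    exact ex_right (ρ a) (ih ρ)
  | ex_left a hF hΓ hΛ _ ih =>
    refine ex_left_of_forall fun b => ?_
    have ihb := ih (Function.update ρ a b)
    rwa [List.map_cons, map_interp_update hΓ, option_map_interp_update hΛ,
      interp_update_inst hF] at ihb
  | neutralization hN _ _ ih₁ ih₂ =>
    exact neutralization (hN.interp v ρ) (ih₁ ρ) (ih₂ ρ)

end LJPlus

/-- Kleene's slash. For `⊃`, `¬` and `∀` it also requires derivability, so that a slashed formula is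
derivable. -/
def Slash : Formula P R 0 → Prop
  | .top => True
  | .bot => False
  | .prop p => Derivable (.prop p : Formula P R 0)
  | .pred r ts => Derivable (.pred r ts : Formula P R 0)
  | .neg A => Derivable (.neg A) ∧ ¬ Slash A
  | .and A B => Slash A ∧ Slash B
  | .or A B => Slash A ∨ Slash B
  | .imp A B => Derivable (.imp A B) ∧ (Slash A → Slash B)
  | .all A => Derivable (.all A) ∧ ∀ a, Slash (A.inst a)
  | .ex A => ∃ a, Slash (A.inst a)
termination_by A => A.size
decreasing_by all_goals simp only [size_inst, size]; omega

theorem Slash.derivable {A : Formula P R 0} (h : Slash A) : Derivable A := by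
  induction A using inst_induction with
  | top => exact .top_ax
  | bot => simp only [Slash] at h
  | prop p => simpa only [Slash] using h
  | pred r ts => simpa only [Slash] using h
  | neg | imp | all => simp only [Slash] at h; exact h.1
  | and A B ihA ihB => simp only [Slash] at h; exact .and_right (ihA h.1) (ihB h.2)
  | or A B ihA ihB =>
    simp only [Slash] at h
    exact h.elim (fun hA => .or_right₁ (ihA hA)) fun hB => .or_right₂ (ihB hB)
  | ex A ih =>
    simp only [Slash] at h
    obtain ⟨a, ha⟩ := h
    exact .ex_right a (ih a ha)

theorem derivable_neg_of_not_slash [IsEmpty P] {N : Formula P R 0} (hN : N.IsPropositional)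
    (h : ¬ Slash N) : Derivable (.neg N) := by
  induction N using inst_induction with
  | top => simp only [Slash, not_true] at h
  | bot => exact .neg_right .bot_ax
  | prop p => exact isEmptyElim p
  | pred r ts => exact hN.elim
  | neg A ih =>
    simp only [Slash, not_and, not_not] at h
    by_cases hA : Slash A
    · exact .neg_right (.neg_left hA.derivable)
    · exact absurd (h (ih hN hA)) hA
  | and A B ihA ihB =>
    simp only [Slash, not_and] at h
    by_cases hA : Slash A
    · exact .neg_right (.and_left₂ (.cons_of_derivable_neg (ihB hN.2 (h hA))))
    · exact .neg_right (.and_left₁ (.cons_of_derivable_neg (ihA hN.1 hA)))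
  | or A B ihA ihB =>
    simp only [Slash, not_or] at h
    exact .neg_right (.or_left (.cons_of_derivable_neg (ihA hN.1 h.1))
      (.cons_of_derivable_neg (ihB hN.2 h.2)))
  | imp A B ihA ihB =>
    simp only [Slash, not_and] at h
    by_cases hB : Slash B
    · exact absurd (fun _ => hB) (h (.imp_right (.thin_left hB.derivable)))
    by_cases hA : Slash A
    · exact .neg_right (.imp_left_of_same hA.derivable (.cons_of_derivable_neg (ihB hN.2 hB)))
    · have hAB : Derivable (A.imp B) :=
        .imp_right (.thin_right (.cons_of_derivable_neg (ihA hN.1 hA)))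
      exact absurd (fun hA' => absurd hA' hA) (h hAB)
  | all A ih =>
    simp only [Slash, not_and, not_forall] at h
    have hNa a : (A.inst a).IsPropositional := isPropositional_subst.2 hN
    by_cases hA : ∀ a, Slash (A.inst a)
    · obtain ⟨a, ha⟩ := h (.all_right_of_forall fun a => (hA a).derivable)
      exact absurd (hA a) ha
    · obtain ⟨a, ha⟩ := not_forall.1 hA
      exact .neg_right (.all_left a (.cons_of_derivable_neg (ih a (hNa a) ha)))
  | ex A ih =>
    simp only [Slash, not_exists] at h
    exact .neg_right (.ex_left_of_forall fun a =>
      .cons_of_derivable_neg (ih a (isPropositional_subst.2 hN) (h a)))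

/-- The slash for the formula that `A` becomes when its propositional symbols take the values `v`
and its free variables are renamed by `ρ`. No propositional symbols are left, hence the language
over `Empty`. -/
def SlashUnder (v : P → Bool) (ρ : ℕ → ℕ) (A : Formula P R 0) : Prop :=
  Slash (A.interp v ρ : Formula Empty R 0)

section SlashUnder

variable {v : P → Bool} {ρ : ℕ → ℕ} {A B : Formula P R 0} {F : Formula P R 1}

theorem slashUnder_neg : SlashUnder v ρ (.neg A) ↔
    Derivable (A.neg.interp v ρ : Formula Empty R 0) ∧ ¬ SlashUnder v ρ A := by
  simp only [SlashUnder, interp, Slash]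

theorem slashUnder_and : SlashUnder v ρ (.and A B) ↔ SlashUnder v ρ A ∧ SlashUnder v ρ B := by
  simp only [SlashUnder, interp, Slash]

theorem slashUnder_or : SlashUnder v ρ (.or A B) ↔ SlashUnder v ρ A ∨ SlashUnder v ρ B := by
  simp only [SlashUnder, interp, Slash]

theorem slashUnder_imp : SlashUnder v ρ (.imp A B) ↔
    Derivable ((A.imp B).interp v ρ : Formula Empty R 0) ∧
      (SlashUnder v ρ A → SlashUnder v ρ B) := by
  simp only [SlashUnder, interp, Slash]

theorem slashUnder_all : SlashUnder v ρ (.all F) ↔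
    Derivable (F.all.interp v ρ : Formula Empty R 0) ∧
      ∀ a, Slash ((F.interp v ρ).inst a : Formula Empty R 0) := by
  simp only [SlashUnder, interp, Slash]

theorem slashUnder_ex : SlashUnder v ρ (.ex F) ↔
    ∃ a, Slash ((F.interp v ρ).inst a : Formula Empty R 0) := by
  simp only [SlashUnder, interp, Slash]

theorem slashUnder_inst {a : ℕ} : SlashUnder v ρ (F.inst a) ↔
    Slash ((F.interp v ρ).inst (ρ a) : Formula Empty R 0) := by
  rw [SlashUnder, interp_inst]

theorem slashUnder_update_inst {a : ℕ} (hF : ¬ F.HasVar a) (b : ℕ) :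
    SlashUnder v (Function.update ρ a b) (F.inst a) ↔
      Slash ((F.interp v ρ).inst b : Formula Empty R 0) := by
  rw [SlashUnder, interp_update_inst hF]

theorem slashUnder_update {a : ℕ} (hA : ¬ A.HasVar a) (b : ℕ) :
    SlashUnder v (Function.update ρ a b) A ↔ SlashUnder v ρ A := by
  rw [SlashUnder, interp_update hA, SlashUnder]

theorem slashUnder_or_slashUnder_neg (hA : A.IsPropositional) (v : P → Bool) (ρ : ℕ → ℕ) :
    SlashUnder v ρ A ∨ SlashUnder v ρ (.neg A) :=
  or_iff_not_imp_left.2 fun h =>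
    slashUnder_neg.2 ⟨derivable_neg_of_not_slash (hA.interp v ρ) h, h⟩

theorem LJPlus.derivable_interp {Γ : List (Formula P R 0)} (h : LJPlus Γ (some A))
    (hΓ : ∀ G ∈ Γ, SlashUnder v ρ G) : Derivable (A.interp v ρ : Formula Empty R 0) := by
  have hA : LJPlus (Γ.map (interp v ρ) ++ []) (some (A.interp v ρ : Formula Empty R 0)) :=
    (List.append_nil _).symm ▸ h.interp v ρ
  exact LJPlus.cut_derivable_list _
    (List.forall_mem_map.2 fun G hG => (hΓ G hG).derivable) hA

theorem LJPlus.slashUnder_update_antecedent {Γ : List (Formula P R 0)} {a : ℕ}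
    (hfresh : ∀ G ∈ Γ, ¬ G.HasVar a) (hΓ : ∀ G ∈ Γ, SlashUnder v ρ G) (b : ℕ) :
    ∀ G ∈ Γ, SlashUnder v (Function.update ρ a b) G :=
  fun G hG => (slashUnder_update (hfresh G hG) b).2 (hΓ G hG)

theorem LJPlus.slashUnder_update_succedent {Λ : Option (Formula P R 0)} {a : ℕ}
    (hfresh : ∀ G ∈ Λ, ¬ G.HasVar a) {b : ℕ}
    (hΛ : Λ.elim False (SlashUnder v (Function.update ρ a b))) :
    Λ.elim False (SlashUnder v ρ) := by
  cases Λ with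
  | none => exact hΛ
  | some C => exact (slashUnder_update (hfresh C rfl) b).1 hΛ

end SlashUnder

theorem LJPlus.slashUnder {Γ : List (Formula P R 0)} {Λ : Option (Formula P R 0)}
    (h : LJPlus Γ Λ) (v : P → Bool) (ρ : ℕ → ℕ) (hΓ : ∀ G ∈ Γ, SlashUnder v ρ G) :
    Λ.elim False (SlashUnder v ρ) := by
  induction h generalizing ρ with
      try simp only [List.forall_mem_cons, List.forall_mem_append] at *
  | ax A => exact hΓ.1
  | top_ax => simp only [Option.elim, SlashUnder, interp, Slash]
  | bot_ax => simpa only [SlashUnder, interp, Slash] using hΓ.1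
  | thin_left _ ih => exact ih ρ hΓ.2
  | thin_right _ ih => exact (ih ρ hΓ).elim
  | contraction _ ih => exact ih ρ ⟨hΓ.1, hΓ⟩
  | exchange _ ih => exact ih ρ ⟨hΓ.1, hΓ.2.2.1, hΓ.2.1, hΓ.2.2.2⟩
  | cut _ _ ih₁ ih₂ => exact ih₂ ρ ⟨ih₁ ρ hΓ.1, hΓ.2⟩
  | and_right _ _ ih₁ ih₂ => exact slashUnder_and.2 ⟨ih₁ ρ hΓ, ih₂ ρ hΓ⟩
  | and_left₁ _ ih => exact ih ρ ⟨(slashUnder_and.1 hΓ.1).1, hΓ.2⟩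
  | and_left₂ _ ih => exact ih ρ ⟨(slashUnder_and.1 hΓ.1).2, hΓ.2⟩
  | or_left _ _ ih₁ ih₂ =>
    exact (slashUnder_or.1 hΓ.1).elim (fun hA => ih₁ ρ ⟨hA, hΓ.2⟩) fun hB => ih₂ ρ ⟨hB, hΓ.2⟩
  | or_right₁ _ ih => exact slashUnder_or.2 (.inl (ih ρ hΓ))
  | or_right₂ _ ih => exact slashUnder_or.2 (.inr (ih ρ hΓ))
  | neg_right h ih =>
    exact slashUnder_neg.2 ⟨(neg_right h).derivable_interp hΓ, fun hA => ih ρ ⟨hA, hΓ⟩⟩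
  | neg_left _ ih => exact (slashUnder_neg.1 hΓ.1).2 (ih ρ hΓ.2)
  | imp_right h ih =>
    exact slashUnder_imp.2 ⟨(imp_right h).derivable_interp hΓ, fun hA => ih ρ ⟨hA, hΓ⟩⟩
  | imp_left _ _ ih₁ ih₂ =>
    exact ih₂ ρ ⟨(slashUnder_imp.1 hΓ.1).2 (ih₁ ρ hΓ.2.1), hΓ.2.2⟩
  | all_right a hF hfresh h ih =>
    exact slashUnder_all.2 ⟨(all_right a hF hfresh h).derivable_interp hΓ, fun b =>
      (slashUnder_update_inst hF b).1 (ih _ (slashUnder_update_antecedent hfresh hΓ b))⟩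
  | all_left a _ ih => exact ih ρ ⟨slashUnder_inst.2 ((slashUnder_all.1 hΓ.1).2 _), hΓ.2⟩
  | ex_right a _ ih => exact slashUnder_ex.2 ⟨ρ a, slashUnder_inst.1 (ih ρ hΓ)⟩
  | ex_left a hF hfresh hΛ _ ih =>
    obtain ⟨b, hb⟩ := slashUnder_ex.1 hΓ.1
    exact slashUnder_update_succedent hΛ (ih (Function.update ρ a b)
      ⟨(slashUnder_update_inst hF b).2 hb, slashUnder_update_antecedent hfresh hΓ.2 b⟩)
  | neutralization hN _ _ ih₁ ih₂ =>
    exact (slashUnder_or_slashUnder_neg hN v ρ).elim (fun h => ih₁ ρ ⟨h, hΓ⟩) fun h =>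
      ih₂ ρ ⟨h, hΓ⟩

theorem Derivable.slashUnder {A : Formula P R 0} (h : Derivable A) (v : P → Bool) (ρ : ℕ → ℕ) :
    SlashUnder v ρ A :=
  LJPlus.slashUnder h v ρ (List.forall_mem_nil _)

theorem Derivable.exists_slashUnder_inst {F : Formula P R 1} (h : Derivable (.ex F))
    (v : P → Bool) : ∃ a, SlashUnder v id (F.inst a) :=
  (slashUnder_ex.1 (h.slashUnder v id)).imp fun _ ha => slashUnder_inst.2 ha

/-- The entailment `A ⊢ B` (for `true`) or `B ⊢ A` (for `false`) in the context `Γ`. The direction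
reverses at a negation or on the left of an implication, as the polarity of an occurrence does. -/
def DirectedEntails (Γ : List (Formula P R 0)) (s : Bool) (A B : Formula P R 0) : Prop :=
  if s then LJPlus (A :: Γ) (some B) else LJPlus (B :: Γ) (some A)

section DirectedEntails

variable {Γ : List (Formula P R 0)} {s : Bool} {A A' B B' : Formula P R 0} {F F' : Formula P R 1}

theorem DirectedEntails.refl (A : Formula P R 0) : DirectedEntails Γ s A A := by
  cases s <;> exact LJPlus.of_mem List.mem_cons_self

theorem DirectedEntails.neg (h : DirectedEntails Γ (!s) A A') :
    DirectedEntails Γ s (.neg A) (.neg A') := by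
  cases s <;> exact LJPlus.neg_mono h

theorem DirectedEntails.and (hA : DirectedEntails Γ s A A') (hB : DirectedEntails Γ s B B') :
    DirectedEntails Γ s (.and A B) (.and A' B') := by
  cases s <;> exact LJPlus.and_mono hA hB

theorem DirectedEntails.or (hA : DirectedEntails Γ s A A') (hB : DirectedEntails Γ s B B') :
    DirectedEntails Γ s (.or A B) (.or A' B') := by
  cases s <;> exact LJPlus.or_mono hA hB

theorem DirectedEntails.imp (hA : DirectedEntails Γ (!s) A A') (hB : DirectedEntails Γ s B B') :
    DirectedEntails Γ s (.imp A B) (.imp A' B') := by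
  cases s <;> exact LJPlus.imp_mono hA hB

theorem DirectedEntails.all (h : ∀ a, DirectedEntails Γ s (F.inst a) (F'.inst a)) :
    DirectedEntails Γ s (.all F) (.all F') := by
  cases s <;> exact LJPlus.all_mono h

theorem DirectedEntails.ex (h : ∀ a, DirectedEntails Γ s (F.inst a) (F'.inst a)) :
    DirectedEntails Γ s (.ex F) (.ex F') := by
  cases s <;> exact LJPlus.ex_mono h

end DirectedEntails

theorem directedEntails_interp {Γ : List (Formula P R 0)} {v : P → Bool} (A : Formula P R 0)
    (s : Bool)
    (h : ∀ p t, A.Occ p t → DirectedEntails Γ (s == t) (ofBool (v p)) (.prop p)) :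
    DirectedEntails Γ s (A.interp v id) A := by
  have h_not {A : Formula P R 0} {s : Bool}
      (h : ∀ p t, A.Occ p (!t) → DirectedEntails Γ (s == t) (ofBool (v p)) (.prop p)) :
      ∀ p t, A.Occ p t → DirectedEntails Γ ((!s) == t) (ofBool (v p)) (.prop p) := fun p t ht =>
    have hst : (s == !t) = ((!s) == t) := by cases s <;> cases t <;> rfl
    hst ▸ h p (!t) ((Bool.not_not t).symm ▸ ht)
  induction A using inst_induction generalizing s with
  | top | bot => exact .refl _
  | prop p => exact beq_true s ▸ h p true ⟨rfl, rfl⟩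
  | pred r ts => simpa only [interp, Var.rename_id] using DirectedEntails.refl _
  | neg A ih => exact (ih _ (h_not h)).neg
  | and A B ihA ihB =>
    exact (ihA s fun p t ht => h p t (.inl ht)).and (ihB s fun p t ht => h p t (.inr ht))
  | or A B ihA ihB =>
    exact (ihA s fun p t ht => h p t (.inl ht)).or (ihB s fun p t ht => h p t (.inr ht))
  | imp A B ihA ihB =>
    exact (ihA _ (h_not fun p t ht => h p t (.inl ht))).imp (ihB s fun p t ht => h p t (.inr ht))
  | all F ih =>
    exact .all fun a => F.interp_inst v id a ▸ ih a s fun p t ht => h p t (occ_inst.1 ht)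
  | ex F ih =>
    exact .ex fun a => F.interp_inst v id a ▸ ih a s fun p t ht => h p t (occ_inst.1 ht)

theorem LJPlus.of_forall_decided {Γ : List (Formula P R 0)} {Λ : Option (Formula P R 0)}
    {s : Set P} (hs : s.Finite)
    (h : ∀ Δ, Γ ⊆ Δ → (∀ p ∈ s, .prop p ∈ Δ ∨ .neg (.prop p) ∈ Δ) → LJPlus Δ Λ) :
    LJPlus Γ Λ := by
  induction s, hs using Set.Finite.induction_on generalizing Γ with
  | empty => exact h Γ (List.Subset.refl Γ) fun p hp => hp.elim
  | @insert q s _ _ ih =>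
    have with_mem {N : Formula P R 0}
        (hN : ∀ Δ : List (Formula P R 0), N ∈ Δ → .prop q ∈ Δ ∨ .neg (.prop q) ∈ Δ) :
        LJPlus (N :: Γ) Λ :=
      ih fun Δ hΔ hs => h Δ (List.subset_of_cons_subset hΔ)
        (Set.forall_mem_insert.2 ⟨hN Δ (hΔ List.mem_cons_self), hs⟩)
    exact neutralization (N := .prop q) trivial (with_mem fun _ => .inl) (with_mem fun _ => .inr)

/-- The values `w` differ from `v` only by making positive occurrences in `A` false and negative
ones true, so that `A` under `w` implies `A` under `v`. -/
def Formula.Strengthens {n : ℕ} (A : Formula P R n) (w v : P → Bool) : Prop :=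
  ∀ p s, A.Occ p s → w p = v p ∨ w p = !s

theorem SlashUnder.derivable_interp {v : P → Bool} {A : Formula P R 0}
    (h : SlashUnder v id A) : Derivable (A.interp v id : Formula P R 0) := by
  have hA := LJPlus.interp h.derivable (Empty.elim : Empty → Bool) (Q := P) id
  rwa [List.map_nil, Option.map_some, interp_interp] at hA

theorem derivable_of_forall_strengthens {A : Formula P R 0}
    (h : ∀ v, ∃ w, A.Strengthens w v ∧ SlashUnder w id A) : Derivable A := by
  classical
  refine LJPlus.of_forall_decided A.finite_setOf_contains fun Δ _ hΔ => ?_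
  obtain ⟨w, hw, hA⟩ := h fun p => decide (.prop p ∈ Δ)
  refine LJPlus.cut_derivable hA.derivable_interp (directedEntails_interp A true fun p s hs => ?_)
  cases s <;> cases hwp : w p
  · have hp : .prop p ∉ Δ := by simpa [hwp] using hw p false hs
    have hp' : .neg (.prop p) ∈ Δ := (hΔ p (contains_iff_exists_occ.2 ⟨_, hs⟩)).resolve_left hp
    exact LJPlus.of_mem_of_neg_mem List.mem_cons_self (List.mem_cons_of_mem _ hp')
  · exact LJPlus.of_derivable LJPlus.top_ax
  · exact LJPlus.of_bot_mem List.mem_cons_self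
  · have hp : .prop p ∈ Δ := by simpa [hwp] using hw p true hs
    exact LJPlus.of_mem (List.mem_cons_of_mem _ hp)

open Classical in
/-- The values `v`, changed on the symbols of `A` so as to make a unipolar `A` as strong as
possible. -/
noncomputable def Formula.strongest {n : ℕ} (A : Formula P R n) (v : P → Bool) (p : P) : Bool :=
  if A.Contains p then decide (A.Occ p false) else v p

theorem Formula.Unipolar.strongest_eq {n : ℕ} {A : Formula P R n} (hA : A.Unipolar)
    {p : P} {s : Bool} (hs : A.Occ p s) (v : P → Bool) : A.strongest v p = !s := by
  have hs' : A.Occ p false ↔ s = false := ⟨(hA p).occ_unique hs, fun h => h ▸ hs⟩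
  rw [strongest, if_pos (contains_iff_exists_occ.2 ⟨s, hs⟩)]
  cases s <;> simp [hs']

theorem Formula.Unipolar.derivable_inst {A : Formula P R 1} (hA : A.Unipolar) {v : P → Bool}
    {a : ℕ} (h : SlashUnder (A.strongest v) id (A.inst a)) : Derivable (A.inst a) :=
  derivable_of_forall_strengthens fun _ =>
    ⟨A.strongest v, fun _ _ hs => .inr (hA.strongest_eq (occ_inst.1 hs) v), h⟩

theorem Formula.Unipolar.derivable_of_forall_strongest {n : ℕ} {A : Formula P R n}
    (hA : A.Unipolar) {C : Formula P R 0}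
    (hAC : ∀ p s, C.Occ p s → A.Contains p → A.Occ p s)
    (h : ∀ v, SlashUnder (A.strongest v) id C) : Derivable C := by
  refine derivable_of_forall_strengthens fun v => ⟨A.strongest v, fun p s hs => ?_, h v⟩
  by_cases hp : A.Contains p
  · exact .inr (hA.strongest_eq (hAC p s hs hp) v)
  · exact .inl (if_neg hp)

theorem existenceProperty_and {A : Formula P R 1} (hA : A.Unipolar) (B : Formula P R 0) :
    ExistenceProperty (.and A B.weaken) := by
  intro h
  have hB : Derivable B := LJPlus.cut_derivable h <| .ex_left_of_forall fun a => by
    rw [and_weaken_inst]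
    exact .and_left₂ (.ax B)
  obtain ⟨a, ha⟩ := h.exists_slashUnder_inst (A.strongest fun _ => true)
  rw [and_weaken_inst, slashUnder_and] at ha
  refine ⟨a, ?_⟩
  rw [and_weaken_inst]
  exact .and_right (hA.derivable_inst ha.1) hB

theorem existenceProperty_or {A : Formula P R 1} (hA : A.Unipolar) {B : Formula P R 0}
    (hAB : ∀ p, A.Contains p → B.Contains p → (Formula.or A B.weaken).UnipolarAt p) :
    ExistenceProperty (.or A B.weaken) := by
  intro h
  have hocc p s (hs : B.Occ p s) (hp : A.Contains p) : A.Occ p s := by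
    obtain ⟨t, ht⟩ := contains_iff_exists_occ.1 hp
    have hst : s = t := (hAB p hp (contains_iff_exists_occ.2 ⟨s, hs⟩)).occ_unique
      (.inr (occ_subst.2 hs)) (.inl ht)
    exact hst ▸ ht
  simp only [or_weaken_inst]
  by_cases hB : ∀ v, SlashUnder (A.strongest v) id B
  · exact ⟨0, .or_right₂ (hA.derivable_of_forall_strongest hocc hB)⟩
  · obtain ⟨v, hv⟩ := not_forall.1 hB
    obtain ⟨a, ha⟩ := h.exists_slashUnder_inst (A.strongest v)
    rw [or_weaken_inst, slashUnder_or] at ha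
    exact ⟨a, .or_right₁ (hA.derivable_inst (ha.resolve_right hv))⟩

theorem existenceProperty_imp {A : Formula P R 1} (hA : A.Unipolar) {B : Formula P R 0}
    (hB : B.IsPropositional)
    (hAB : ∀ p, A.Contains p → B.Contains p → (Formula.imp B.weaken A).UnipolarAt p) :
    ExistenceProperty (.imp B.weaken A) := by
  intro h
  have hocc p s (hs : B.neg.Occ p s) (hp : A.Contains p) : A.Occ p s := by
    obtain ⟨t, ht⟩ := contains_iff_exists_occ.1 hp
    have hst : s = t := (hAB p hp (contains_iff_exists_occ.2 ⟨!s, hs⟩)).occ_unique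
      (.inl (occ_subst.2 hs)) (.inr ht)
    exact hst ▸ ht
  simp only [imp_weaken_inst]
  by_cases hnB : ∀ v, SlashUnder (A.strongest v) id B.neg
  · have hB' : Derivable B.neg := hA.derivable_of_forall_strongest hocc hnB
    exact ⟨0, .imp_right (.thin_right (.cons_of_derivable_neg hB'))⟩
  · obtain ⟨v, hv⟩ := not_forall.1 hnB
    have hBv := (slashUnder_or_slashUnder_neg hB (A.strongest v) id).resolve_right hv
    obtain ⟨a, ha⟩ := h.exists_slashUnder_inst (A.strongest v)
    rw [imp_weaken_inst, slashUnder_imp] at ha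
    exact ⟨a, .imp_right (.thin_left (hA.derivable_inst (ha.2 hBv)))⟩

end LJP

theorem mainTheorem5 {P : Type*} {R : ℕ → Type*}
    (A : LJP.Formula P R 1) (hA : A.Unipolar) (B : LJP.Formula P R 0) :
    LJP.ExistenceProperty (.and A B.weaken) ∧
    ((∀ p : P, A.Contains p → B.Contains p → (LJP.Formula.or A B.weaken).UnipolarAt p) →
      LJP.ExistenceProperty (.or A B.weaken)) ∧
    (B.IsPropositional →
      (∀ p : P, A.Contains p → B.Contains p → (LJP.Formula.imp B.weaken A).UnipolarAt p) →
      LJP.ExistenceProperty (.imp B.weaken A)) :=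
  ⟨LJP.existenceProperty_and hA B, LJP.existenceProperty_or hA, LJP.existenceProperty_imp hA⟩
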